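/- There exists a Niemeier lattice with no roots. That is, there exist a free $\mathbb{Z}$-module $N$ of rank $24$ and a symmetric bilinear form $(\cdot,\cdot)\colon N\times N\to\mathbb{Z}$ that is positive definite ($(x,x)>0$ for all $x\neq 0$), even ($(x,x)\in 2\mathbb{Z}$ for all $x\in N$) and unimodular (the map $N\to\operatorname{Hom}(N,\mathbb{Z})$, $x\mapsto (x,\cdot)$, is an isomorphism), such that no $r\in N$ satisfies $(r,r)=2$. -/

import Mathlib

/-- A lattice is a finitely generated free `ℤ`-module with a symmetric integer-valued bilinear
form. `(x, y)` is `B x y`, and the norm of `x` is `B x x`. -/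
structure IsLattice {L : Type*} [AddCommGroup L] (B : LinearMap.BilinForm ℤ L) : Prop where
  free : Module.Free ℤ L
  finite : Module.Finite ℤ L
  symm : ∀ x y : L, B x y = B y x

/-- Positive definiteness. -/
def IsPositiveDefiniteLattice {L : Type*} [AddCommGroup L] (B : LinearMap.BilinForm ℤ L) : Prop :=
  ∀ x : L, x ≠ 0 → 0 < B x x

/-- A lattice is even if every element has even norm. -/
def IsEvenLattice {L : Type*} [AddCommGroup L] (B : LinearMap.BilinForm ℤ L) : Prop :=
  ∀ x : L, Even (B x x)

/-- A lattice is unimodular if it equals its dual, that is, if `x ↦ (x, ·)` identifies `L` with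
`Hom(L, ℤ)`. -/
def IsUnimodularLattice {L : Type*} [AddCommGroup L] (B : LinearMap.BilinForm ℤ L) : Prop :=
  B.IsPerfPair

/-- A Niemeier lattice is a 24-dimensional even unimodular positive definite lattice. -/
structure IsNiemeierLattice {L : Type*} [AddCommGroup L] (B : LinearMap.BilinForm ℤ L) : Prop where
  isLattice : IsLattice B
  finrank_eq : Module.finrank ℤ L = 24
  positiveDefinite : IsPositiveDefiniteLattice B
  even : IsEvenLattice B
  unimodular : IsUnimodularLattice B

/-- A root of a lattice is a vector of norm 2. -/
def IsLatticeRoot {L : Type*} [AddCommGroup L] (B : LinearMap.BilinForm ℤ L) (r : L) : Prop :=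
  B r r = 2

/-! The Leech lattice works. Its vectors are v/√8 for v in the row span of `basisMatrix`, so norm 2
means ∑ v_j² = 16. All v_j have the same parity. If odd, ∑ v_j² ≥ 24. If even, v = 2y with ∑ y_j² =
4 and y mod 2 a Golay codeword; no nonzero codeword has weight ≤ 4, so v = 4z with ∑ z_j² = 1 and ∑
z_j is odd. But ∑ v_j ≡ 0 mod 8 in the even case, so ∑ z_j is even. -/

open Matrix

namespace LeechLattice

/-! ### The extended binary Golay code

Binary words of length 24 are encoded as the bits of natural numbers. -/

/-- A basis of the extended binary Golay code: eleven shifts of the generator polynomial of the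
cyclic Golay code, extended by a parity bit in position `0`, and the all-ones word. -/
def golayWord (k : Fin 12) : ℕ :=
  if k = 11 then 2 ^ 24 - 1 else 6378 <<< k.val + 1

/-- The predicate `p` holds for the sums modulo 2 of `w` and any sublist of a list of words. -/
def spanAll (p : ℕ → Bool) : List ℕ → ℕ → Bool
  | [], w => p w
  | r :: rs, w => spanAll p rs w && spanAll p rs (r ^^^ w)

/-- The number of ones of a binary word in its first 24 positions. -/
def weight (w : ℕ) : ℕ := Finset.card {j : Fin 24 | w.testBit j}

/-- Checked over all 2^12 codewords. The true minimum is 8; excluding weights up to 4 suffices. -/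
theorem golay_minWeight :
    spanAll (fun w => w = 0 ∨ 4 < weight w) (List.ofFn golayWord) 0 = true := by
  decide +kernel

/-- Turns the finite check into a statement on integer combinations: the parity of each coefficient
selects the branch of `spanAll`. -/
theorem exists_of_spanAll {n : ℕ} {p : ℕ → Bool} {r : Fin n → ℕ} {v : ℕ}
    (hp : spanAll p (List.ofFn r) v = true) (c : Fin n → ℤ) :
    ∃ w, p w = true ∧ ∀ j : ℕ, (w.testBit j = true ↔
      Odd ((v.testBit j).toInt + ∑ i, c i * ((r i).testBit j).toInt)) := by
  induction n generalizing v with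
  | zero => exact ⟨v, by simpa [spanAll] using hp, fun j => by cases v.testBit j <;> simp⟩
  | succ n ih =>
    rw [List.ofFn_succ, spanAll, Bool.and_eq_true] at hp
    rcases Int.even_or_odd (c 0) with h0 | h0
    · obtain ⟨w, hw, h⟩ := ih hp.1 fun i => c i.succ
      refine ⟨w, hw, fun j => ?_⟩
      rw [h j, Fin.sum_univ_succ, add_left_comm, add_comm (c 0 * _),
        Int.odd_add (n := c 0 * _), iff_true_right (h0.mul_right _)]
    · obtain ⟨w, hw, h⟩ := ih hp.2 fun i => c i.succ
      refine ⟨w, hw, fun j => ?_⟩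
      rw [h j, Fin.sum_univ_succ, ← add_assoc, Int.odd_add, Int.odd_add, Nat.testBit_xor]
      refine iff_congr ?_ Iff.rfl
      cases (r 0).testBit j <;> cases v.testBit j <;> simp [h0]

/-- An integral vector congruent modulo 2 to a Golay codeword and with square sum at most 4 has
only even entries. -/
theorem even_of_sum_sq_le_four (c : Fin 12 → ℤ) (y : Fin 24 → ℤ)
    (hy : ∀ j, (Odd (y j) ↔ Odd (∑ i, c i * ((golayWord i).testBit j).toInt)))
    (h4 : ∑ j, y j ^ 2 ≤ 4) (j : Fin 24) : Even (y j) := by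
  obtain ⟨w, hw, h⟩ := exists_of_spanAll golay_minWeight c
  simp only [Nat.zero_testBit, Bool.toInt_false, zero_add] at h
  simp_rw [← h] at hy
  rcases of_decide_eq_true hw with rfl | hlt
  · simpa using hy j
  · exfalso
    have : (weight w : ℤ) ≤ ∑ j, y j ^ 2 := by
      rw [weight, Finset.card_filter, Nat.cast_sum]
      refine Finset.sum_le_sum fun j _ => ?_
      split_ifs with hj
      · have : y j ≠ 0 := by
          rintro h0
          have := (hy j).2 hj
          simp [h0] at this
        simpa using Int.add_one_le_iff.2 (sq_pos_of_ne_zero this)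
      · simpa using sq_nonneg (y j)
    omega

/-! ### A basis of the Leech lattice -/

/-- The rows span the Leech lattice, scaled by `√8`. -/
def basisMatrix : Matrix (Fin 24) (Fin 24) ℤ := fun i j =>
  if i = 0 then (if j = 0 then 8 else 0)
  else if i.val < 12 then (if j = 0 ∨ j = i then 4 else 0)
  else if i.val < 23 then (if (6378 <<< (i.val - 12) + 1).testBit j then 2 else 0)
  else if j = 0 then -3 else 1

/-- The Gram matrix of the Leech lattice. -/
def gram : Matrix (Fin 24) (Fin 24) ℤ := fun i j => (basisMatrix * basisMatrixᵀ) i j / 8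

theorem basisMatrix_mul_transpose : basisMatrix * basisMatrixᵀ = (8 : ℤ) • gram := by
  have h : ∀ i j, (basisMatrix * basisMatrixᵀ) i j = 8 * gram i j := by decide +kernel
  ext i j
  simpa using h i j

theorem even_gram_diag : ∀ i, Even (gram i i) := by decide +kernel

theorem det_basisMatrix : basisMatrix.det = 2 ^ 36 := by
  have h : ∀ i j : Fin 24, j ≤ i ∨ 2 * basisMatrix i j = 0 := by decide +kernel
  rw [det_of_isLowerTriangular _ fun i j hij => by
    simpa using (h i j).resolve_left (not_le_of_gt hij)]
  -- The diagonal is 8, eleven 4s, eleven 2s and 1.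
  decide +kernel

/-- (2^36)² = 8^24. -/
theorem det_gram : gram.det = 1 := by
  have h := congrArg det basisMatrix_mul_transpose
  rw [det_mul, det_transpose, det_basisMatrix, det_smul, Fintype.card_fin] at h
  norm_num at h
  exact h

/-- The bilinear form of the Leech lattice. -/
noncomputable def form : LinearMap.BilinForm ℤ (Fin 24 → ℤ) := toBilin' gram

theorem eight_mul_form (x y : Fin 24 → ℤ) :
    8 * form x y = (x ᵥ* basisMatrix) ⬝ᵥ (y ᵥ* basisMatrix) := by
  rw [form, toBilin'_apply', ← smul_eq_mul, ← dotProduct_smul, ← smul_mulVec,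
    ← basisMatrix_mul_transpose, ← mulVec_mulVec, dotProduct_mulVec, mulVec_transpose]

theorem eight_mul_form_self (x : Fin 24 → ℤ) :
    8 * form x x = ∑ j, (x ᵥ* basisMatrix) j ^ 2 := by
  simp only [eight_mul_form, dotProduct, sq]

theorem form_symm (x y : Fin 24 → ℤ) : form x y = form y x := by
  have h := eight_mul_form x y
  rw [dotProduct_comm, ← eight_mul_form] at h
  omega

theorem form_pos : IsPositiveDefiniteLattice form := by
  intro x hx
  have hne : x ᵥ* basisMatrix ≠ 0 := fun h =>
    hx (eq_zero_of_vecMul_eq_zero (by rw [det_basisMatrix]; norm_num) h)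
  obtain ⟨j, hj⟩ := Function.ne_iff.1 hne
  have : 0 < ∑ j, (x ᵥ* basisMatrix) j ^ 2 :=
    Finset.sum_pos' (fun i _ => sq_nonneg _) ⟨j, Finset.mem_univ _, sq_pos_of_ne_zero hj⟩
  have := eight_mul_form_self x
  omega

/-- Cross terms occur twice, so evenness on the basis suffices. -/
theorem form_even : IsEvenLattice form := by
  intro x
  have hx : x ∈ Submodule.span ℤ (Set.range (Pi.basisFun ℤ (Fin 24))) := by
    simp [(Pi.basisFun ℤ (Fin 24)).span_eq]
  induction hx using Submodule.span_induction with
  | mem x hx =>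
    obtain ⟨i, rfl⟩ := hx
    simpa [form, toBilin'_single] using even_gram_diag i
  | zero => simp
  | add x y _ _ hx hy =>
    have : form (x + y) (x + y) = form x x + form y y + (form x y + form x y) := by
      simp only [map_add, LinearMap.add_apply, form_symm y x]
      ring
    rw [this]
    exact (hx.add hy).add ⟨_, rfl⟩
  | smul a x _ hx =>
    rw [map_smul, map_smul, LinearMap.smul_apply]
    exact (hx.mul_left a).mul_left a

theorem form_bijective : Function.Bijective form := by
  have hu : IsUnit gram.det := by simp [det_gram]
  have happ (x y : Fin 24 → ℤ) : form x y = (x ᵥ* gram) ⬝ᵥ y := by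
    rw [form, toBilin'_apply', dotProduct_mulVec]
  refine ⟨(injective_iff_map_eq_zero _).2 fun x hx => ?_, fun f => ?_⟩
  · refine eq_zero_of_vecMul_eq_zero hu.ne_zero (dotProduct_eq_zero _ fun y => ?_)
    rw [← happ, hx, LinearMap.zero_apply]
  · refine ⟨(fun i => f (Pi.single i 1)) ᵥ* gram⁻¹, (Pi.basisFun ℤ (Fin 24)).ext fun i => ?_⟩
    rw [happ, vecMul_vecMul, nonsing_inv_mul _ hu, vecMul_one]
    simp

theorem form_isNiemeierLattice : IsNiemeierLattice form where
  isLattice := ⟨inferInstance, inferInstance, form_symm⟩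
  finrank_eq := by simp
  positiveDefinite := form_pos
  even := form_even
  unimodular := LinearMap.IsPerfPair.of_bijective _ form_bijective

/-! ### Congruences satisfied by the Leech lattice -/

theorem vecMul_modEq_two (x : Fin 24 → ℤ) (j : Fin 24) :
    (x ᵥ* basisMatrix) j ≡ x 23 [ZMOD 2] := by
  have h : ∀ i j : Fin 24, 2 ∣ (if i = 23 then 1 else 0) - basisMatrix i j := by
    decide +kernel
  calc
    (x ᵥ* basisMatrix) j ≡ ∑ i, x i * (if i = 23 then 1 else 0) [ZMOD 2] :=
      Int.ModEq.sum (s := Finset.univ) fun i _ => (Int.modEq_iff_dvd.2 (h i j)).mul_left (x i)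
    _ = x 23 := by simp

theorem sum_vecMul_modEq_eight (x : Fin 24 → ℤ) :
    ∑ j, (x ᵥ* basisMatrix) j ≡ 4 * x 23 [ZMOD 8] := by
  -- The Golay rows are doubled words of weight 8, with sum 16; the last row has sum -3 + 23 = 20.
  have h : ∀ i : Fin 24, ∑ j, basisMatrix i j ≡ (if i = 23 then 4 else 0) [ZMOD 8] := by
    decide +kernel
  calc
    ∑ j, (x ᵥ* basisMatrix) j = ∑ i, x i * ∑ j, basisMatrix i j := by
      simp only [vecMul, dotProduct, Finset.mul_sum]
      exact Finset.sum_comm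
    _ ≡ ∑ i, x i * (if i = 23 then 4 else 0) [ZMOD 8] :=
      Int.ModEq.sum fun i _ => (h i).mul_left _
    _ = 4 * x 23 := by simp [mul_comm]

theorem vecMul_modEq_four {x : Fin 24 → ℤ} {k : ℤ} (hk : x 23 = 2 * k) (j : Fin 24) :
    (x ᵥ* basisMatrix) j ≡
      2 * ∑ i, (if i = 11 then k else x (i.natAdd 12)) * ((golayWord i).testBit j).toInt
      [ZMOD 4] := by
  have h0 : ∀ (i : Fin 12) (j : Fin 24), basisMatrix (i.castAdd 12) j ≡ 0 [ZMOD 4] := by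
    decide +kernel
  have h1 : ∀ (i : Fin 12) (j : Fin 24), i ≠ 11 →
      basisMatrix (i.natAdd 12) j = 2 * ((golayWord i).testBit j).toInt := by
    decide +kernel
  -- Since -3 ≡ 1 mod 4, twice the last row acts as twice the all-ones word, with coefficient `k`.
  have h2 : ∀ j : Fin 24, 2 * basisMatrix 23 j ≡ 2 * ((golayWord 11).testBit j).toInt [ZMOD 4] := by
    decide +kernel
  have hsum : (x ᵥ* basisMatrix) j =
      ∑ i : Fin 12, x (i.castAdd 12) * basisMatrix (i.castAdd 12) j +
        ∑ i : Fin 12, x (i.natAdd 12) * basisMatrix (i.natAdd 12) j :=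
    Fin.sum_univ_add (a := 12) (b := 12) fun i : Fin 24 => x i * basisMatrix i j
  rw [hsum, Finset.mul_sum]
  have hleft : ∑ i : Fin 12, x (i.castAdd 12) * basisMatrix (i.castAdd 12) j ≡ 0 [ZMOD 4] := by
    simpa using Int.ModEq.sum (s := Finset.univ) fun i _ => (h0 i j).mul_left (x (i.castAdd 12))
  rw [← zero_add (∑ i, 2 * _)]
  refine hleft.add (Int.ModEq.sum fun i _ => ?_)
  split_ifs with hi
  · subst hi
    have h23 : (Fin.natAdd 12 (11 : Fin 12) : Fin 24) = 23 := rfl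
    rw [h23, hk, mul_right_comm, mul_comm _ k, mul_left_comm 2 k]
    exact (h2 j).mul_left k
  · rw [h1 i j hi, mul_left_comm]

theorem form_self_ne_two (x : Fin 24 → ℤ) : form x x ≠ 2 := by
  intro h
  have hsq := eight_mul_form_self x
  rw [h] at hsq
  rcases Int.even_or_odd' (x 23) with ⟨k, hk | hk⟩
  · have hev (j) : ∃ y, (x ᵥ* basisMatrix) j = 2 * y := by
      have := (vecMul_modEq_two x j).dvd
      exact ⟨(x ᵥ* basisMatrix) j / 2, by omega⟩
    choose y hy using hev
    have hy4 : ∑ j, y j ^ 2 ≤ 4 := by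
      simp only [hy, mul_pow, ← Finset.mul_sum] at hsq
      omega
    have heven := even_of_sum_sq_le_four
      (fun i => if i = 11 then k else x (i.natAdd 12)) y (fun j => by
      have := (vecMul_modEq_four hk j).dvd
      rw [hy] at this
      rw [Int.odd_iff, Int.odd_iff]
      omega) hy4
    choose z hz using fun j => (heven j).two_dvd
    have hz1 : ∑ j, z j ^ 2 = 1 := by
      simp only [hy, hz, mul_pow, ← Finset.mul_sum] at hsq
      omega
    have hsum := (sum_vecMul_modEq_eight x).dvd
    simp only [hy, hz, ← Finset.mul_sum] at hsum
    -- z² - z = (z - 1)z is even.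
    have hpar : ∑ j, z j ^ 2 ≡ ∑ j, z j [ZMOD 2] := Int.ModEq.sum fun j _ => by
      rw [Int.modEq_iff_dvd]
      have := (Int.even_mul_succ_self (z j - 1)).two_dvd
      rw [← dvd_neg]
      convert this using 1
      ring
    rw [hz1] at hpar
    have := hpar.dvd
    omega
  · have hle : ∑ _j : Fin 24, (1 : ℤ) ≤ ∑ j, (x ᵥ* basisMatrix) j ^ 2 := by
      refine Finset.sum_le_sum fun j _ => ?_
      have hne : (x ᵥ* basisMatrix) j ≠ 0 := by
        have := (vecMul_modEq_two x j).dvd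
        omega
      exact Int.add_one_le_iff.2 (sq_pos_of_ne_zero hne)
    simp only [Finset.sum_const, Finset.card_univ, Fintype.card_fin, nsmul_eq_mul] at hle
    push_cast at hle
    omega

end LeechLattice

theorem theorem2p4p3 :
    ∃ (L : Type) (_ : AddCommGroup L) (B : LinearMap.BilinForm ℤ L),
      IsNiemeierLattice B ∧ ∀ r : L, ¬ IsLatticeRoot B r :=
  ⟨Fin 24 → ℤ, inferInstance, LeechLattice.form, LeechLattice.form_isNiemeierLattice,
    LeechLattice.form_self_ne_two⟩
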